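/- Let $G=(V,E)$ be a finite simple graph with largest degree $\Delta$. For $x\in(-1,1)$ let $\mathcal A(G,x)$ be the set of real positive definite (symmetric) $V\times V$ matrices $M$ with $M_{v,v}=1$ for every vertex $v$ and $M_{u,v}=x$ for every edge $(u,v)$ of $G$. Let $0\le x<1$ and, if $\Delta\ge 2$, suppose that $x<\frac1{\Delta-1}$. Then there is a unique matrix $A_G(x)$ that maximizes the determinant over $\mathcal A(G,x)$, and its inverse $B_G(x)=A_G(x)^{-1}$ is an M-matrix, that is, all its off-diagonal entries are non-positive and all its (complex) eigenvalues have non-negative real part. Moreover, if $x>0$, then $y_G(u,v):=-B_G(x)_{u,v}>0$ for every edge $(u,v)\in E(G)$. -/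

import Mathlib

/-- The set `𝒜(G, x)` of real `V × V` matrices that are positive definite (in particular symmetric),
have all diagonal entries equal to `1`, and have the entry `x` at every edge of `G`. -/
def admissibleMatrices {V : Type*} [Fintype V] (G : SimpleGraph V) (x : ℝ) :
    Set (Matrix V V ℝ) :=
  {M | M.PosDef ∧ (∀ v, M v v = 1) ∧ ∀ u v, G.Adj u v → M u v = x}

/-- `A` maximizes the determinant over `𝒜(G, x)`. -/
def IsDetMaximizer {V : Type*} [Fintype V] [DecidableEq V] (G : SimpleGraph V) (x : ℝ)
    (A : Matrix V V ℝ) : Prop :=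
  A ∈ admissibleMatrices G x ∧ ∀ M ∈ admissibleMatrices G x, M.det ≤ A.det

/-- A real square matrix is an M-matrix if its off-diagonal entries are non-positive and all its
complex eigenvalues have non-negative real part. -/
def IsMMatrix {V : Type*} [Fintype V] [DecidableEq V] (B : Matrix V V ℝ) : Prop :=
  (∀ i j, i ≠ j → B i j ≤ 0) ∧
    ∀ μ : ℂ, Module.End.HasEigenvalue (Matrix.toLin' (B.map (fun r : ℝ => (r : ℂ)))) μ → 0 ≤ μ.re

namespace Matrix

variable {V : Type*} [Fintype V]

/-- Minimum principle for positive definite matrices with non-positive off-diagonal entries. -/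
theorem PosDef.nonneg_of_offDiag_nonpos {B : Matrix V V ℝ} (hB : B.PosDef)
    (hoff : ∀ i j, i ≠ j → B i j ≤ 0) {z : V → ℝ}
    (hz : ∀ i, 0 ≤ z i ∨ 0 ≤ (B *ᵥ z) i) (i : V) : 0 ≤ z i := by
  set n : V → ℝ := fun i => max (-z i) 0 with hn
  set p : V → ℝ := fun i => max (z i) 0 with hp
  have hnp : n = p - z := by
    funext i
    simp only [hn, hp, Pi.sub_apply]
    rcases le_total (z i) 0 with h | h
    · rw [max_eq_left (by linarith), max_eq_right h]; ring
    · rw [max_eq_right (by linarith), max_eq_left h]; ring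
  have hquad : n ⬝ᵥ (B *ᵥ n) ≤ 0 := by
    refine Finset.sum_nonpos fun i _ => ?_
    rcases le_or_gt 0 (z i) with h | h
    · have : n i = 0 := max_eq_right (by linarith)
      simp [this]
    · have hBz := (hz i).resolve_left (not_le.mpr h)
      refine mul_nonpos_of_nonneg_of_nonpos (le_max_right _ _) ?_
      rw [hnp, mulVec_sub, Pi.sub_apply]
      have : (B *ᵥ p) i ≤ 0 := by
        refine Finset.sum_nonpos fun j _ => ?_
        rcases eq_or_ne i j with rfl | hij
        · have : p i = 0 := max_eq_right h.le
          simp [this]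
        · exact mul_nonpos_of_nonpos_of_nonneg (hoff i j hij) (le_max_right _ _)
      linarith
  have hn0 : n = 0 := by
    by_contra hne
    have := hB.dotProduct_mulVec_pos hne
    rw [star_trivial] at this
    linarith
  have : max (-z i) 0 = 0 := congrFun hn0 i
  have := le_max_left (-z i) 0
  linarith

theorem isClosed_setOf_posSemidef : IsClosed {M : Matrix V V ℝ | M.PosSemidef} := by
  simp only [posSemidef_iff_dotProduct_mulVec, IsHermitian, Set.ofPred_and, Set.ofPred_forall]
  refine (isClosed_eq (by fun_prop) continuous_id).inter
    (isClosed_iInter fun z => isClosed_le continuous_const ?_)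
  fun_prop

variable [DecidableEq V]

/-- The path product inequality for inverses of positive definite matrices with non-positive
off-diagonal entries. -/
theorem PosDef.mul_le_of_offDiag_nonpos {A B : Matrix V V ℝ} (hB : B.PosDef)
    (hoff : ∀ i j, i ≠ j → B i j ≤ 0) (hBA : B * A = 1) (hdiag : ∀ i, A i i = 1)
    (i j k : V) : A i j * A j k ≤ A i k := by
  suffices h : 0 ≤ A i k - A j k * A i j by linarith
  refine hB.nonneg_of_offDiag_nonpos hoff
    (z := fun i => A i k - A j k * A i j) (fun i => ?_) i
  rcases eq_or_ne i j with rfl | hij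
  · left; simp [hdiag]
  · right
    have : (B *ᵥ fun i => A i k - A j k * A i j) i
        = (B * A) i k - A j k * (B * A) i j := by
      simp only [mulVec, dotProduct, mul_apply, Finset.mul_sum, ← Finset.sum_sub_distrib]
      exact Finset.sum_congr rfl fun _ _ => by ring
    rw [this, hBA, one_apply_ne hij, one_apply]
    split_ifs <;> norm_num

open scoped ComplexOrder MatrixOrder in
/-- A positive semidefinite real matrix is a Gram matrix. -/
theorem PosSemidef.exists_eq_conjTranspose_mul_self {B : Matrix V V ℝ} (hB : B.PosSemidef) :
    ∃ S : Matrix V V ℝ, B = Sᴴ * S :=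
  CStarAlgebra.nonneg_iff_eq_star_mul_self.mp hB.nonneg

/-- A positive definite matrix with trace equal to its size and determinant at least one is
the identity. -/
theorem PosDef.eq_one_of_trace_of_one_le_det {P : Matrix V V ℝ} (hP : P.PosDef)
    (htr : P.trace = Fintype.card V) (hdet : 1 ≤ P.det) : P = 1 := by
  have hpos := hP.eigenvalues_pos
  set e := hP.1.eigenvalues with he
  have hd : P.det = ∏ i, e i := by simpa using hP.1.det_eq_prod_eigenvalues
  have ht : P.trace = ∑ i, e i := by simpa using hP.1.trace_eq_sum_eigenvalues
  have hlog : 0 ≤ ∑ i, Real.log (e i) := by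
    rw [← Real.log_prod (fun i _ => (hpos i).ne'), ← hd]
    exact Real.log_nonneg hdet
  have hle : ∀ i ∈ Finset.univ, 0 ≤ e i - 1 - Real.log (e i) := fun i _ => by
    linarith [Real.log_le_sub_one_of_pos (hpos i)]
  have hsum : ∑ i, (e i - 1 - Real.log (e i)) = 0 := by
    refine le_antisymm ?_ (Finset.sum_nonneg hle)
    rw [Finset.sum_sub_distrib, Finset.sum_sub_distrib, ← ht, htr]
    simpa using hlog
  have hone : e = fun _ => 1 := by
    funext i
    by_contra hne
    have h0 := (Finset.sum_eq_zero_iff_of_nonneg hle).1 hsum i (Finset.mem_univ i)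
    linarith [Real.log_lt_sub_one_of_pos (hpos i) hne]
  have hspec := hP.1.spectral_theorem
  rw [← he, hone] at hspec
  have h1 : diagonal ((RCLike.ofReal : ℝ → ℝ) ∘ fun _ : V => (1 : ℝ)) = 1 := by
    ext i j; simp [diagonal_apply, one_apply]
  rw [h1, map_one] at hspec
  exact hspec

/-- Among positive definite matrices `M` with `tr (A⁻¹ M) = n`, the matrix `A` is the only one
whose determinant is at least `det A`. -/
theorem PosDef.eq_of_trace_inv_mul_of_det_le {A M : Matrix V V ℝ} (hA : A.PosDef)
    (hM : M.PosDef) (htr : (A⁻¹ * M).trace = Fintype.card V) (hdet : A.det ≤ M.det) :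
    M = A := by
  obtain ⟨S, hS⟩ := hA.inv.posSemidef.exists_eq_conjTranspose_mul_self
  have hAu : IsUnit A.det := hA.det_pos.ne'.isUnit
  have hSdet : Sᴴ.det * S.det * A.det = 1 := by
    rw [← det_mul, ← hS, ← det_mul, nonsing_inv_mul _ hAu, det_one]
  have hS0 : S.det ≠ 0 := fun h => by simp [h] at hSdet
  have hSu : IsUnit S := (isUnit_iff_isUnit_det S).2 hS0.isUnit
  have hP : (S * M * Sᴴ).PosDef := (IsUnit.posDef_star_right_conjugate_iff hSu).2 hM
  have h1 : S * M * Sᴴ = 1 := by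
    refine hP.eq_one_of_trace_of_one_le_det ?_ ?_
    · rw [← htr, hS, trace_mul_comm, ← mul_assoc]
    · rw [det_mul, det_mul, ← hSdet]
      have hc : 0 < Sᴴ.det * S.det := by
        rw [← det_mul, ← hS]; exact hA.inv.det_pos
      nlinarith
  have h2 : M * (Sᴴ * S) = 1 := by
    have h3 : S * (M * Sᴴ) = 1 := by rw [← mul_assoc, h1]
    have h4 := mul_eq_one_comm.1 h3
    rw [← mul_assoc, h4]
  rw [← hS] at h2
  calc M = M * (A⁻¹ * A) := by rw [nonsing_inv_mul _ hAu, mul_one]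
    _ = A := by rw [← mul_assoc, h2, one_mul]

/-- First order condition for a one-sided local maximum of the determinant. -/
theorem trace_inv_mul_nonpos_of_det_le {A N : Matrix V V ℝ} (hA : 0 < A.det) {δ : ℝ}
    (hδ : 0 < δ) (h : ∀ t, 0 < t → t < δ → (A + t • N).det ≤ A.det) :
    (A⁻¹ * N).trace ≤ 0 := by
  have hu : IsUnit A.det := hA.ne'.isUnit
  have hfac : ∀ t : ℝ, A + t • N = A * (1 + t • (A⁻¹ * N)) := fun t => by
    rw [mul_add, mul_one, mul_smul_comm, ← mul_assoc, mul_nonsing_inv _ hu, one_mul]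
  set p := (det (1 + (Polynomial.X : Polynomial ℝ) • (A⁻¹ * N).map Polynomial.C)).divX.divX
  have hle : ∀ t, 0 < t → t < δ → (A⁻¹ * N).trace + p.eval t * t ≤ 0 := by
    intro t ht0 ht
    have h1 := h t ht0 ht
    rw [hfac, det_mul, det_one_add_smul] at h1
    change A.det * (1 + (A⁻¹ * N).trace * t + p.eval t * t ^ 2) ≤ A.det at h1
    have h2 : A.det * (t * ((A⁻¹ * N).trace + p.eval t * t)) ≤ 0 := by nlinarith
    by_contra! h3
    exact absurd h2 (not_le.2 (mul_pos hA (mul_pos ht0 h3)))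
  have hcont : Continuous fun t : ℝ => (A⁻¹ * N).trace + p.eval t * t := by fun_prop
  have hlim : Filter.Tendsto (fun t : ℝ => (A⁻¹ * N).trace + p.eval t * t)
      (nhdsWithin 0 (Set.Ioi 0)) (nhds (A⁻¹ * N).trace) := by
    have := (hcont.tendsto 0).mono_left (nhdsWithin_le_nhds (s := Set.Ioi (0 : ℝ)))
    simpa using this
  refine le_of_tendsto hlim ?_
  filter_upwards [Ioo_mem_nhdsGT hδ] with t ht using hle t ht.1 ht.2

/-- A coordinate is bounded by the quadratic form of a positive definite matrix. -/
theorem PosDef.sq_le_inv_mul_quadratic {A : Matrix V V ℝ} (hA : A.PosDef) (z : V → ℝ) (u : V) :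
    z u ^ 2 ≤ A⁻¹ u u * (z ⬝ᵥ (A *ᵥ z)) := by
  have hb : 0 < A⁻¹ u u := hA.inv.diag_pos
  have hu : IsUnit A.det := hA.det_pos.ne'.isUnit
  set b := A⁻¹ u u
  set e : V → ℝ := Pi.single u 1
  set w := A⁻¹ *ᵥ e
  have hAw : A *ᵥ w = e := by
    simp only [w, mulVec_mulVec, mul_nonsing_inv _ hu, one_mulVec]
  have hAt : Aᵀ = A := hA.1
  have hwz : w ⬝ᵥ (A *ᵥ z) = z u := by
    rw [dotProduct_mulVec, ← mulVec_transpose, hAt, hAw]; simp [e]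
  have hzw : z ⬝ᵥ (A *ᵥ w) = z u := by rw [hAw]; simp [e]
  have hww : w ⬝ᵥ (A *ᵥ w) = b := by rw [hAw]; simp [e, w, b]
  have h := hA.posSemidef.dotProduct_mulVec_nonneg (b • z - z u • w)
  simp only [star_trivial, mulVec_sub, mulVec_smul, sub_dotProduct, dotProduct_sub,
    smul_dotProduct, dotProduct_smul, hwz, hzw, hww, smul_eq_mul] at h
  have h2 : 0 ≤ b * (b * (z ⬝ᵥ (A *ᵥ z)) - z u ^ 2) := by nlinarith
  have := nonneg_of_mul_nonneg_right h2 hb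
  linarith

/-- Small symmetric perturbations of one off-diagonal entry keep positive semidefiniteness. -/
theorem PosDef.posSemidef_add_smul_single {A : Matrix V V ℝ} (hA : A.PosDef) (u v : V) {t : ℝ}
    (ht : |t| * (A⁻¹ u u + A⁻¹ v v) ≤ 1) :
    (A + t • (single u v (1 : ℝ) + single v u 1)).PosSemidef := by
  refine PosSemidef.of_dotProduct_mulVec_nonneg ?_ fun z => ?_
  · simp only [IsHermitian, conjTranspose_add, conjTranspose_smul, hA.1.eq,
      conjTranspose_single, star_trivial]
    rw [add_comm (single v u (1 : ℝ))]
  · have hq : star z ⬝ᵥ ((A + t • (single u v (1 : ℝ) + single v u 1)) *ᵥ z)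
        = z ⬝ᵥ (A *ᵥ z) + t * (2 * (z u * z v)) := by
      have hs : ∀ a b : V, single a b (1 : ℝ) *ᵥ z = Pi.single a (z b) := fun a b => by
        rw [single_mulVec, one_mul]; rfl
      simp only [star_trivial, add_mulVec, smul_mulVec, dotProduct_add, dotProduct_smul, hs,
        dotProduct_single, smul_eq_mul]
      ring
    rw [hq]
    have hu := hA.sq_le_inv_mul_quadratic z u
    have hv := hA.sq_le_inv_mul_quadratic z v
    have hq0 : 0 ≤ z ⬝ᵥ (A *ᵥ z) := by
      simpa using hA.posSemidef.dotProduct_mulVec_nonneg z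
    set q := z ⬝ᵥ (A *ᵥ z)
    have h1 : |2 * (z u * z v)| ≤ (A⁻¹ u u + A⁻¹ v v) * q := by
      rw [abs_le]
      constructor <;> nlinarith [sq_nonneg (z u + z v), sq_nonneg (z u - z v)]
    have h2 : |t * (2 * (z u * z v))| ≤ q := by
      rw [abs_mul]
      calc |t| * |2 * (z u * z v)| ≤ |t| * ((A⁻¹ u u + A⁻¹ v v) * q) := by gcongr
        _ = |t| * (A⁻¹ u u + A⁻¹ v v) * q := by ring
        _ ≤ 1 * q := by gcongr
        _ = q := one_mul q
    linarith [neg_abs_le (t * (2 * (z u * z v)))]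

theorem PosSemidef.abs_le_one_of_diag_eq_one {M : Matrix V V ℝ} (hM : M.PosSemidef)
    (hdiag : ∀ v, M v v = 1) (i j : V) : |M i j| ≤ 1 := by
  have hs : M j i = M i j := hM.1.apply i j
  have h1 := hM.dotProduct_mulVec_nonneg (Pi.single i 1 + Pi.single j 1)
  have h2 := hM.dotProduct_mulVec_nonneg (Pi.single i 1 - Pi.single j 1)
  simp [mulVec_add, mulVec_sub, hdiag, hs] at h1 h2
  rw [abs_le]
  constructor <;> linarith

open scoped ComplexOrder in
/-- Eigenvalues of a positive semidefinite real matrix have non-negative real part. -/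
theorem PosSemidef.re_eigenvalue_nonneg {B : Matrix V V ℝ} (hB : B.PosSemidef) {μ : ℂ}
    (hμ : Module.End.HasEigenvalue (toLin' (B.map (fun r : ℝ => (r : ℂ)))) μ) : 0 ≤ μ.re := by
  obtain ⟨S, hS⟩ := hB.exists_eq_conjTranspose_mul_self
  have hC : (B.map (fun r : ℝ => (r : ℂ))).PosSemidef := by
    have : B.map (fun r : ℝ => (r : ℂ))
        = (S.map (fun r : ℝ => (r : ℂ)))ᴴ * S.map (fun r : ℝ => (r : ℂ)) := by
      rw [hS]; ext i j; simp [mul_apply]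
    rw [this]
    exact posSemidef_conjTranspose_mul_self _
  obtain ⟨z, hz⟩ := hμ.exists_hasEigenvector
  have h1 := hz.apply_eq_smul
  rw [toLin'_apply] at h1
  have h2 := hC.dotProduct_mulVec_nonneg z
  rw [h1, dotProduct_smul, smul_eq_mul] at h2
  have h3 : (0 : ℂ) < star z ⬝ᵥ z := dotProduct_star_self_pos_iff.2 hz.2
  obtain ⟨h3r, h3i⟩ := Complex.pos_iff.1 h3
  have h2r := (Complex.nonneg_iff.1 h2).1
  rw [Complex.mul_re, ← h3i, mul_zero, sub_zero] at h2r
  exact nonneg_of_mul_nonneg_left h2r h3r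

end Matrix

open Matrix

section

variable {V : Type*} [Fintype V]

/-- Trace of `B * M` when `B` is supported on the diagonal and the edges of `G`. -/
theorem trace_mul_eq_of_mem_admissibleMatrices {G : SimpleGraph V} {x : ℝ}
    {B M A : Matrix V V ℝ} (hM : M ∈ admissibleMatrices G x) (hA : A ∈ admissibleMatrices G x)
    (hB : ∀ u v, u ≠ v → ¬ G.Adj u v → B u v = 0) : (B * M).trace = (B * A).trace := by
  simp only [trace, diag_apply, mul_apply]
  refine Finset.sum_congr rfl fun u _ => Finset.sum_congr rfl fun v _ => ?_
  rcases eq_or_ne u v with rfl | huv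
  · rw [hM.2.1, hA.2.1]
  by_cases hadj : G.Adj u v
  · rw [hM.2.2 v u hadj.symm, hA.2.2 v u hadj.symm]
  · rw [hB u v huv hadj, zero_mul, zero_mul]

variable [DecidableEq V]

/-- Entrywise relaxation of `admissibleMatrices`: edge entries are at least `x`, and semidefinite
matrices are allowed. -/
def relaxedMatrices (G : SimpleGraph V) (x : ℝ) : Set (Matrix V V ℝ) :=
  {M | M.PosSemidef ∧ (∀ v, M v v = 1) ∧ ∀ u v, G.Adj u v → x ≤ M u v}

theorem isCompact_relaxedMatrices (G : SimpleGraph V) (x : ℝ) :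
    IsCompact (relaxedMatrices G x) := by
  have hbox : IsCompact (Set.pi Set.univ fun _ : V => Set.pi Set.univ fun _ : V =>
      Set.Icc (-1 : ℝ) 1) :=
    isCompact_univ_pi fun _ => isCompact_univ_pi fun _ => isCompact_Icc
  refine hbox.of_isClosed_subset ?_ ?_
  · simp only [relaxedMatrices, Set.ofPred_and, Set.ofPred_forall]
    refine isClosed_setOf_posSemidef.inter (IsClosed.inter ?_ ?_)
    · exact isClosed_iInter fun v => isClosed_eq (by fun_prop) continuous_const
    · exact isClosed_iInter fun u => isClosed_iInter fun v => isClosed_iInter fun _ =>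
        isClosed_le continuous_const (by fun_prop)
  · intro M hM i _ j _
    exact abs_le.1 (hM.1.abs_le_one_of_diag_eq_one hM.2.1 i j)

theorem exists_posDef_mem_relaxedMatrices (G : SimpleGraph V) {x : ℝ} (hx0 : 0 ≤ x)
    (hx1 : x < 1) : ∃ M ∈ relaxedMatrices G x, M.PosDef := by
  let M : Matrix V V ℝ := (1 - x) • 1 + x • vecMulVec (fun _ => 1) (star fun _ => 1)
  have hM : M.PosDef :=
    (PosDef.one.smul (sub_pos.2 hx1)).add_posSemidef
      ((posSemidef_vecMulVec_self_star (fun _ : V => (1 : ℝ))).smul hx0)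
  refine ⟨M, ⟨hM.posSemidef, fun v => ?_, fun u v huv => ?_⟩, hM⟩
  · simp [M, vecMulVec_apply]
  · simp [M, vecMulVec_apply, one_apply_ne huv.ne]

theorem exists_isMaxOn_det_relaxedMatrices (G : SimpleGraph V) {x : ℝ} (hx0 : 0 ≤ x)
    (hx1 : x < 1) :
    ∃ A ∈ relaxedMatrices G x, A.PosDef ∧ ∀ M ∈ relaxedMatrices G x, M.det ≤ A.det := by
  obtain ⟨M, hM, hMpd⟩ := exists_posDef_mem_relaxedMatrices G hx0 hx1
  obtain ⟨A, hA, hmax⟩ := (isCompact_relaxedMatrices G x).exists_isMaxOn ⟨M, hM⟩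
    (f := Matrix.det) (by fun_prop)
  have hmax' : ∀ M ∈ relaxedMatrices G x, M.det ≤ A.det := fun M hM => hmax hM
  exact ⟨A, hA, hA.1.posDef_iff_det_ne_zero.2 (hMpd.det_pos.trans_le (hmax' M hM)).ne', hmax'⟩

/-- Complementary slackness for the maximizer over the relaxed set. -/
theorem inv_apply_of_isMaxOn_det {G : SimpleGraph V} {x : ℝ} {A : Matrix V V ℝ}
    (hA : A ∈ relaxedMatrices G x) (hpd : A.PosDef)
    (hmax : ∀ M ∈ relaxedMatrices G x, M.det ≤ A.det) {u v : V} (huv : u ≠ v) :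
    A⁻¹ u v ≤ 0 ∧ (G.Adj u v → x < A u v → A⁻¹ u v = 0) ∧ (¬ G.Adj u v → A⁻¹ u v = 0) := by
  set N : Matrix V V ℝ := single u v 1 + single v u 1 with hN
  have hs : A⁻¹ v u = A⁻¹ u v := hpd.inv.1.apply u v
  have hAs : A v u = A u v := hpd.1.apply u v
  have htr : (A⁻¹ * N).trace = 2 * A⁻¹ u v := by
    rw [hN, mul_add, trace_add, trace_mul_single, trace_mul_single, hs]
    simp; ring
  set c := A⁻¹ u u + A⁻¹ v v
  have hc : 0 < c := add_pos hpd.inv.diag_pos hpd.inv.diag_pos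
  have hNd : ∀ w, N w w = 0 := fun w => by
    have h1 : ¬(u = w ∧ v = w) := fun h => huv (h.1.trans h.2.symm)
    have h2 : ¬(v = w ∧ u = w) := fun h => h1 h.symm
    simp [hN, single_apply_of_ne, h1, h2]
  have hmem : ∀ t, |t| * c ≤ 1 → (G.Adj u v → x ≤ A u v + t) →
      A + t • N ∈ relaxedMatrices G x := by
    intro t ht hedge
    refine ⟨hpd.posSemidef_add_smul_single u v ht, fun w => ?_, fun a b hab => ?_⟩
    · simp [hNd, hA.2.1]
    · by_cases h1 : u = a ∧ v = b
      · obtain ⟨rfl, rfl⟩ := h1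
        have : N u v = 1 := by simp [hN, huv]
        simpa [this] using hedge hab
      by_cases h2 : v = a ∧ u = b
      · obtain ⟨rfl, rfl⟩ := h2
        have : N v u = 1 := by simp [hN, huv, huv.symm]
        simpa [this, hAs] using hedge hab.symm
      · have : N a b = 0 := by simp [hN, h1, h2]
        simpa [this] using hA.2.2 a b hab
  have hle : A⁻¹ u v ≤ 0 := by
    have := trace_inv_mul_nonpos_of_det_le (N := N) hpd.det_pos (inv_pos.2 hc) fun t ht0 ht => by
      refine hmax _ (hmem t ?_ fun h => ?_)
      · rw [abs_of_pos ht0]; exact ((lt_div_iff₀ hc).1 (by rwa [one_div])).le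
      · linarith [hA.2.2 u v h]
    linarith
  have hge : ∀ δ, 0 < δ → (G.Adj u v → x ≤ A u v - δ) → 0 ≤ A⁻¹ u v := by
    intro δ hδ hedge
    have := trace_inv_mul_nonpos_of_det_le (N := -N) hpd.det_pos
      (lt_min hδ (inv_pos.2 hc)) fun t ht0 ht => by
        rw [smul_neg, ← neg_smul]
        refine hmax _ (hmem (-t) ?_ fun h => ?_)
        · rw [abs_neg, abs_of_pos ht0]
          exact ((lt_div_iff₀ hc).1
            (by rw [one_div]; exact ht.trans_le (min_le_right _ _))).le
        · linarith [hedge h, ht.trans_le (min_le_left _ _)]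
    rw [mul_neg, trace_neg] at this
    linarith
  refine ⟨hle, fun hadj hlt => le_antisymm hle ?_, fun hadj => le_antisymm hle ?_⟩
  · exact hge (A u v - x) (by linarith) fun _ => by linarith
  · exact hge 1 one_pos fun h => absurd h hadj

/-- Upper bound on the off-diagonal row sums: if the `d` neighbours of `u` in the support of `B`
all have entry `x` in `A = B⁻¹`, where `(d - 1) x < 1`, then row `u` of `B` is strictly
diagonally dominant. -/
theorem sum_neg_lt_diag {A B : Matrix V V ℝ} (hB : B.PosDef)
    (hoff : ∀ i j, i ≠ j → B i j ≤ 0) (hBA : B * A = 1) (hdiag : ∀ i, A i i = 1) {x : ℝ}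
    (hx0 : 0 ≤ x) (hx1 : x < 1) (hsymm : A.IsSymm) (u : V)
    (hedge : ∀ w, u ≠ w → B u w ≠ 0 → A u w = x) {H : Finset V}
    (hH : ∀ w, w ∈ H ↔ u ≠ w ∧ B u w ≠ 0) (hd : ((H.card : ℝ) - 1) * x < 1) :
    ∑ w ∈ H, -B u w < B u u := by
  have hb : 0 < B u u := hB.diag_pos
  have huH : u ∉ H := fun h => ((hH u).1 h).1 rfl
  have hrow : ∀ f : V → ℝ, ∑ k, B u k * f k = B u u * f u - ∑ k ∈ H, -B u k * f k := by
    intro f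
    have : ∑ k, B u k * f k = ∑ k ∈ insert u H, B u k * f k := by
      refine (Finset.sum_subset (Finset.subset_univ _) fun k _ hk => ?_).symm
      rw [Finset.mem_insert, hH] at hk
      push Not at hk
      rw [hk.2 (Ne.symm hk.1), zero_mul]
    rw [this, Finset.sum_insert huH]
    simp [Finset.sum_neg_distrib]
  set S := ∑ w ∈ H, -B u w with hS
  have hS0 : 0 ≤ S := Finset.sum_nonneg fun w hw => by
    linarith [hoff u w ((hH w).1 hw).1]
  have hw : ∀ w ∈ H, (1 - x ^ 2) * -B u w + x ^ 2 * S ≤ B u u * x := by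
    intro w hw
    obtain ⟨huw, hBw⟩ := (hH w).1 hw
    have h0 : ∑ k, B u k * A k w = 0 := by
      have : (B * A) u w = 0 := by rw [hBA, one_apply_ne huw]
      rwa [mul_apply] at this
    rw [hrow fun k => A k w, hedge w huw hBw] at h0
    have h1 : ∑ k ∈ H, (-B u k * x ^ 2 + if k = w then (1 - x ^ 2) * -B u w else 0)
        ≤ ∑ k ∈ H, -B u k * A k w := by
      refine Finset.sum_le_sum fun k hk => ?_
      obtain ⟨huk, hBk⟩ := (hH k).1 hk
      split_ifs with hkw
      · subst hkw; rw [hdiag]; apply le_of_eq; ring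
      · have hp := hB.mul_le_of_offDiag_nonpos hoff hBA hdiag k u w
        rw [hedge w huw hBw, hsymm.apply u k, hedge k huk hBk] at hp
        have := hoff u k huk
        nlinarith
    rw [Finset.sum_add_distrib, ← Finset.sum_mul, Finset.sum_ite_eq' , if_pos hw] at h1
    linarith
  have hsum := Finset.sum_le_sum hw
  rw [Finset.sum_add_distrib, ← Finset.mul_sum, ← hS] at hsum
  simp only [Finset.sum_const, nsmul_eq_mul] at hsum
  set d : ℝ := (H.card : ℝ)
  rcases H.eq_empty_or_nonempty with rfl | hne
  · simpa [hS] using hb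
  have hd1 : (1 : ℝ) ≤ d := Nat.one_le_cast.2 hne.card_pos
  have hkey : d * x < 1 + (d - 1) * x ^ 2 := by nlinarith
  by_contra! hcon
  have hpos : 0 < 1 + (d - 1) * x ^ 2 := by nlinarith [sq_nonneg x]
  have h1 : (1 + (d - 1) * x ^ 2) * S ≤ d * x * B u u := by linarith
  have h2 : d * x * B u u ≤ d * x * S := by gcongr
  nlinarith

/-- Entries of `A = B⁻¹` outside the support of `B` are smaller than `x`, or non-positive. -/
theorem apply_lt_or_nonpos_of_inv_apply_eq_zero {A B : Matrix V V ℝ}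
    (hoff : ∀ i j, i ≠ j → B i j ≤ 0) (hBA : B * A = 1) {x : ℝ} (v : V)
    (hBv : ∀ w, w ≠ v → B w v ≠ 0 → A w v = x)
    (hdom : ∀ u, ∑ w ∈ Finset.univ.filter (fun w => u ≠ w ∧ B u w ≠ 0), -B u w < B u u)
    {u : V} (huv : u ≠ v) (hBuv : B u v = 0) : A u v < x ∨ A u v ≤ 0 := by
  obtain ⟨m, hm, hmax⟩ := Finset.exists_max_image
    (Finset.univ.filter fun w => w ≠ v ∧ B w v = 0) (fun w => A w v) ⟨u, by simp [huv, hBuv]⟩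
  simp only [Finset.mem_filter, Finset.mem_univ, true_and] at hm hmax
  have hum := hmax u ⟨huv, hBuv⟩
  set H := Finset.univ.filter (fun w => m ≠ w ∧ B m w ≠ 0)
  have hmH : m ∉ H := by simp [H]
  have hrow : B m m * A m v = ∑ k ∈ H, -B m k * A k v := by
    have h0 : (B * A) m v = 0 := by rw [hBA, one_apply_ne hm.1]
    rw [mul_apply] at h0
    have : ∑ k, B m k * A k v = ∑ k ∈ insert m H, B m k * A k v := by
      refine (Finset.sum_subset (Finset.subset_univ _) fun k _ hk => ?_).symm
      simp only [H, Finset.mem_insert, Finset.mem_filter, Finset.mem_univ, true_and] at hk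
      push Not at hk
      rw [hk.2 (Ne.symm hk.1), zero_mul]
    rw [this, Finset.sum_insert hmH] at h0
    simp only [neg_mul, Finset.sum_neg_distrib]
    linarith
  by_contra! hcon
  have hle : ∑ k ∈ H, -B m k * A k v ≤ (∑ k ∈ H, -B m k) * A m v := by
    rw [Finset.sum_mul]
    refine Finset.sum_le_sum fun k hk => ?_
    simp only [H, Finset.mem_filter, Finset.mem_univ, true_and] at hk
    refine mul_le_mul_of_nonneg_left ?_ (by linarith [hoff m k hk.1])
    have hkv : k ≠ v := by rintro rfl; exact hk.2 hm.2
    by_cases hBk : B k v = 0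
    · exact hmax k ⟨hkv, hBk⟩
    · rw [hBv k hkv hBk]; linarith
  have := hdom m
  nlinarith

/-- Existence of an admissible matrix whose inverse is supported on `G`, with negative entries at
the edges when `x > 0`. -/
theorem exists_mem_admissibleMatrices_inv_nonpos (G : SimpleGraph V) [DecidableRel G.Adj] {x : ℝ}
    (hx0 : 0 ≤ x) (hx1 : x < 1)
    (hx : 2 ≤ G.maxDegree → x < 1 / ((G.maxDegree : ℝ) - 1)) :
    ∃ A ∈ admissibleMatrices G x, (∀ u v, u ≠ v → A⁻¹ u v ≤ 0) ∧
      (∀ u v, u ≠ v → ¬ G.Adj u v → A⁻¹ u v = 0) ∧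
      (0 < x → ∀ u v, G.Adj u v → A⁻¹ u v < 0) := by
  obtain ⟨A, hA, hpd, hmax⟩ := exists_isMaxOn_det_relaxedMatrices G hx0 hx1
  have hkkt := fun u v (huv : u ≠ v) => inv_apply_of_isMaxOn_det hA hpd hmax huv
  have hoff : ∀ u v, u ≠ v → A⁻¹ u v ≤ 0 := fun u v h => (hkkt u v h).1
  have hBA : A⁻¹ * A = 1 := nonsing_inv_mul _ hpd.det_pos.ne'.isUnit
  have hsymm : A.IsSymm := hpd.1
  have hadj : ∀ u v, u ≠ v → A⁻¹ u v ≠ 0 → G.Adj u v := fun u v huv hB => by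
    by_contra h; exact hB ((hkkt u v huv).2.2 h)
  have hedge : ∀ u v, u ≠ v → A⁻¹ u v ≠ 0 → A u v = x := fun u v huv hB => by
    have h := hadj u v huv hB
    by_contra hne
    exact hB ((hkkt u v huv).2.1 h (lt_of_le_of_ne (hA.2.2 u v h) (Ne.symm hne)))
  have hdom : ∀ u, ∑ w ∈ Finset.univ.filter (fun w => u ≠ w ∧ A⁻¹ u w ≠ 0), -A⁻¹ u w
      < A⁻¹ u u := by
    intro u
    refine sum_neg_lt_diag hpd.inv hoff hBA hA.2.1 hx0 hx1 hsymm u (hedge u) (by simp) ?_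
    set H := Finset.univ.filter (fun w => u ≠ w ∧ A⁻¹ u w ≠ 0)
    have hcard : H.card ≤ G.maxDegree := by
      refine le_trans (Finset.card_le_card fun w hw => ?_) (G.degree_le_maxDegree u)
      simp only [H, Finset.mem_filter, Finset.mem_univ, true_and] at hw
      exact (G.mem_neighborFinset u w).2 (hadj u w hw.1 hw.2)
    have hcard' : (H.card : ℝ) ≤ G.maxDegree := by exact_mod_cast hcard
    by_cases h2 : 2 ≤ G.maxDegree
    · have h2' : (2 : ℝ) ≤ G.maxDegree := by exact_mod_cast h2
      have := (lt_div_iff₀ (by linarith)).1 (hx h2)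
      nlinarith
    · have h2' : (G.maxDegree : ℝ) ≤ 1 := by exact_mod_cast (by omega : G.maxDegree ≤ 1)
      nlinarith
  have hzero : ∀ u v, u ≠ v → A⁻¹ u v = 0 → A u v < x ∨ A u v ≤ 0 := fun u v huv hB =>
    apply_lt_or_nonpos_of_inv_apply_eq_zero hoff hBA v (fun w => hedge w v) hdom huv hB
  have heq : ∀ u v, G.Adj u v → A u v = x := fun u v h => by
    by_contra hne
    have hlt := lt_of_le_of_ne (hA.2.2 u v h) (Ne.symm hne)
    rcases hzero u v h.ne ((hkkt u v h.ne).2.1 h hlt) with h1 | h1 <;> linarith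
  refine ⟨A, ⟨hpd, hA.2.1, heq⟩, hoff, fun u v huv => (hkkt u v huv).2.2, fun hxpos u v h => ?_⟩
  refine lt_of_le_of_ne (hoff u v h.ne) fun h0 => ?_
  rcases hzero u v h.ne h0 with h1 | h1 <;> linarith [heq u v h]

end

theorem theorem9 {V : Type*} [Fintype V] [DecidableEq V] (G : SimpleGraph V)
    [DecidableRel G.Adj] (x : ℝ) (hx0 : 0 ≤ x) (hx1 : x < 1)
    (hx : 2 ≤ G.maxDegree → x < 1 / ((G.maxDegree : ℝ) - 1)) :
    (∃! A : Matrix V V ℝ, IsDetMaximizer G x A) ∧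
      ∀ A : Matrix V V ℝ, IsDetMaximizer G x A →
        IsMMatrix A⁻¹ ∧ (0 < x → ∀ u v, G.Adj u v → 0 < -(A⁻¹ u v)) := by
  obtain ⟨A, hA, hoff, hsupp, hneg⟩ := exists_mem_admissibleMatrices_inv_nonpos G hx0 hx1 hx
  have huniq : ∀ M ∈ admissibleMatrices G x, A.det ≤ M.det → M = A := fun M hM hle => by
    refine hA.1.eq_of_trace_inv_mul_of_det_le hM.1 ?_ hle
    rw [trace_mul_eq_of_mem_admissibleMatrices hM hA hsupp,
      nonsing_inv_mul _ hA.1.det_pos.ne'.isUnit, trace_one]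
  have hmax : IsDetMaximizer G x A := ⟨hA, fun M hM => by
    by_contra! h
    rw [huniq M hM h.le] at h
    exact h.false⟩
  have hall : ∀ M, IsDetMaximizer G x M → M = A := fun M hM => huniq M hM.1 (hM.2 A hA)
  refine ⟨⟨A, hmax, hall⟩, fun M hM => ?_⟩
  rw [hall M hM]
  exact ⟨⟨hoff, fun μ hμ => hA.1.inv.posSemidef.re_eigenvalue_nonneg hμ⟩,
    fun hxpos u v h => neg_pos.2 (hneg hxpos u v h)⟩
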